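/- Fix a number of arms $K$, a threshold $\tau\in\mathbb{R}$ and $R>0$. A problem instance $(M,\mu)$ consists of a vector $\mu\in\mathbb{R}^K$ of mean rewards and a matrix $M\in[0,1]^{K\times K}$ with $M_{ij}=1-M_{ji}$, such that, with the Borda scores $p_i=\frac{1}{K-1}\sum_{j\neq i}M_{ij}$, every positive arm ($\mu_i\ge\tau$) has a strictly larger Borda score than every negative arm ($\mu_j<\tau$). In each round a (possibly randomized) sequential algorithm may pull an arm $i$, observing an independent $\mathcal N(\mu_i,R^2)$ reward, or duel two arms $i,j$, observing an independent Bernoulli$(M_{ij})$ outcome, or stop and output a set of arms as its guess of the set $S$ of positive arms. For an instance having positive and negative arms let $i_u$ be a positive arm of least Borda score and $i_l$ a negative arm of largest Borda score; put $\Delta^c_i=p_i-p_{i_u}$ for positive $i$, $\Delta^c_i=p_{i_l}-p_i$ for negative $i$, and $$H_{c,1}=\sum_{i\notin\{i_u,i_l\}}\frac{1}{(\Delta^c_i)^2}\in[0,\infty]\qquad(1/0=\infty).$$ Let $0<\delta\le 0.15$ and $c=\min\{\frac1{10},\frac{R^2}{2}\}$. Let $a,b$ be two arms and let $\mathcal{A}$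 be an algorithm that is told that $a$ is positive and $b$ is negative, that uses only duels, and that is $\delta$-correct: on every problem instance in which $a$ is positive and $b$ is negative, the probability that $\mathcal A$ stops and outputs a set other than $S$ is at most $\delta$. (This holds in particular if $\mathcal A$ stops and outputs $S$ with probability at least $1-\delta$ on all those instances.) Then, for every problem instance $(M,\mu)$ such that $M_{ij}\ge\frac38$ for all $i,j\in[K]$, and such that $a$ and $b$ are a worst positive arm $i_u$ and a best negative arm $i_l$ of it, the expected number of duels of $\mathcal A$ satisfies $$\mathbb{E}_{M,\mu}\big[n_{\mathrm{duel}}^{\mathcal A}\big]\;\ge\; c\,H_{c,1}\,\log\frac{1}{2\delta}.$$ -/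

import Mathlib

open MeasureTheory ProbabilityTheory
open scoped ENNReal

namespace TBPDC

/-- A query: pull one arm, or duel two arms. -/
inductive Query (K : ℕ) where
  | pull (i : Fin K)
  | duel (i j : Fin K)

/-- In each round an algorithm either makes a query, or halts and declares the arms of `S` to be
the positive ones (and all other arms to be negative). -/
inductive Decision (K : ℕ) where
  | query (q : Query K)
  | halt (S : Finset (Fin K))

/-- The Borda score `p_i = (K - 1)⁻¹ ∑_{j ≠ i} M_ij`. -/
noncomputable def bordaScore {K : ℕ} (M : Fin K → Fin K → unitInterval) (i : Fin K) : ℝ :=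
  (∑ j ∈ Finset.univ.erase i, (M i j : ℝ)) / ((K : ℝ) - 1)

/-- A problem instance `(M, μ)` with `K` arms and threshold `τ`: `M i j` is the probability that arm
`i` wins a duel against arm `j`, and `μ i` is the mean reward of arm `i`. The Borda score of any
positive arm (`τ ≤ μ i`) exceeds the Borda score of any negative arm (`μ j < τ`). -/
structure Problem (K : ℕ) (τ : ℝ) where
  M : Fin K → Fin K → unitInterval
  μ : Fin K → ℝ
  M_symm : ∀ i j, (M i j : ℝ) = 1 - M j i
  separated : ∀ i j, τ ≤ μ i → μ j < τ → bordaScore M j < bordaScore M i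

namespace Problem

variable {K : ℕ} {τ : ℝ}

/-- The set of positive arms. -/
noncomputable def pos (I : Problem K τ) : Finset (Fin K) :=
  Finset.univ.filter fun i => τ ≤ I.μ i

/-- The Borda score of arm `i`. -/
noncomputable def p (I : Problem K τ) (i : Fin K) : ℝ := bordaScore I.M i

/-- `u` is a positive arm of least Borda score. -/
def IsWorstPositive (I : Problem K τ) (u : Fin K) : Prop :=
  u ∈ I.pos ∧ ∀ j ∈ I.pos, I.p u ≤ I.p j

/-- `l` is a negative arm of largest Borda score. -/
def IsBestNegative (I : Problem K τ) (l : Fin K) : Prop :=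
  l ∉ I.pos ∧ ∀ j, j ∉ I.pos → I.p j ≤ I.p l

/-- The duel gap of arm `i`, relative to the worst positive arm `u` and the best negative
arm `l`. -/
noncomputable def gap (I : Problem K τ) (u l i : Fin K) : ℝ :=
  if i ∈ I.pos then I.p i - I.p u else I.p l - I.p i

/-- The duel complexity `H_{c,1} = ∑_{i ≠ u, l} 1 / gap_i ^ 2`, an extended nonnegative real:
an arm (other than `u` and `l`) of gap `0` contributes `∞`. -/
noncomputable def Hc1 (I : Problem K τ) (u l : Fin K) : ℝ≥0∞ :=
  ∑ i ∈ (Finset.univ.erase u).erase l, (ENNReal.ofReal (I.gap u l i ^ 2))⁻¹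

/-- The law of the answer to a query: a pull of arm `i` returns a reward with law `N(μ_i, R²)`,
a duel of `i` and `j` returns `1` (arm `i` wins) with probability `M_ij` and `0` otherwise. -/
noncomputable def answerLaw (I : Problem K τ) (R : ℝ) : Query K → Measure ℝ
  | .pull i => gaussianReal (I.μ i) (R ^ 2).toNNReal
  | .duel i j => bernoulliMeasure 1 0 (I.M i j)

instance (I : Problem K τ) (R : ℝ) (q : Query K) : IsProbabilityMeasure (I.answerLaw R q) := by
  cases q <;> unfold answerLaw <;> infer_instance

/-- The randomness of a run: the internal random seed of the algorithm (with law `ρ`) and,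
independent of it and of one another, an answer for every round `t` and every query `q`. In each
round the algorithm sees only the answer to the query that it makes, so that, given the past, this
is a fresh sample of the law of that query. -/
noncomputable def runLaw {Ξ : Type*} [MeasurableSpace Ξ] (I : Problem K τ) (R : ℝ)
    (ρ : Measure Ξ) : Measure (Ξ × (ℕ × Query K → ℝ)) :=
  ρ.prod (Measure.infinitePi fun tq : ℕ × Query K => I.answerLaw R tq.2)

end Problem

/-- A sequential, possibly randomized algorithm for `K` arms with seeds in `Ξ`: the decision in
round `t` is a measurable function of the seed and of the answers in the rounds before `t` (these
determine the earlier queries as well). -/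
structure Algorithm (K : ℕ) (Ξ : Type*) [MeasurableSpace Ξ] where
  next : (t : ℕ) → Ξ × (Fin t → ℝ) → Decision K
  measurable_next : ∀ (t : ℕ) (d : Decision K), MeasurableSet {x | next t x = d}

namespace Algorithm

variable {K : ℕ} {Ξ : Type*} [MeasurableSpace Ξ]

/-- The algorithm never makes a pull. -/
def UsesOnlyDuels (A : Algorithm K Ξ) : Prop :=
  ∀ t x i, A.next t x ≠ .query (.pull i)

/-- The answers received in the rounds before round `t` (with the dummy value `0` in rounds in which
no query is made; what follows the first `halt` is never used). -/
def history (A : Algorithm K Ξ) (x : Ξ × (ℕ × Query K → ℝ)) : (t : ℕ) → Fin t → ℝ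
  | 0 => Fin.elim0
  | t + 1 => Fin.snoc (α := fun _ => ℝ) (A.history x t)
      (match A.next t (x.1, A.history x t) with
        | .query q => x.2 (t, q)
        | .halt _ => 0)

/-- The decision in round `t`. -/
def decision (A : Algorithm K Ξ) (x : Ξ × (ℕ × Query K → ℝ)) (t : ℕ) : Decision K :=
  A.next t (x.1, A.history x t)

/-- Round `t` is reached: the algorithm does not halt before it. -/
def Reaches (A : Algorithm K Ξ) (x : Ξ × (ℕ × Query K → ℝ)) (t : ℕ) : Prop :=
  ∀ s < t, ∀ S, A.decision x s ≠ .halt S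

/-- The algorithm terminates and declares `S` to be the set of positive arms. -/
def Outputs (A : Algorithm K Ξ) (x : Ξ × (ℕ × Query K → ℝ)) (S : Finset (Fin K)) : Prop :=
  ∃ t, A.Reaches x t ∧ A.decision x t = .halt S

open Classical in
/-- The number of duels that are made before termination. -/
noncomputable def numDuels (A : Algorithm K Ξ) (x : Ξ × (ℕ × Query K → ℝ)) : ℝ≥0∞ :=
  ∑' t : ℕ, if A.Reaches x t ∧ ∃ i j, A.decision x t = .query (.duel i j) then 1 else 0

/-- On the instance `I`, the algorithm terminates with a wrong answer with probability at
most `δ`. (Terminating with the right answer with probability at least `1 - δ` implies this.) -/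
def ErrsAtMost {τ : ℝ} (A : Algorithm K Ξ) (ρ : Measure Ξ) (R δ : ℝ) (I : Problem K τ) : Prop :=
  I.runLaw R ρ {x | ∃ S, A.Outputs x S ∧ S ≠ I.pos} ≤ ENNReal.ofReal δ

/-- The expected number of duels on the instance `I`. -/
noncomputable def expectedDuels {τ : ℝ} (A : Algorithm K Ξ) (ρ : Measure Ξ) (R : ℝ)
    (I : Problem K τ) : ℝ≥0∞ :=
  ∫⁻ x, A.numDuels x ∂(I.runLaw R ρ)

end Algorithm

end TBPDC

/-! For each arm `i` other than `u` and `l`, shift the winning chances of `i` by some `x` that is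
positive and at least its gap, and move its mean across `τ`. This gives an instance `J` with the
label of `i` flipped and those of `u` and `l` kept (`exists_flip`), so the algorithm must be
δ-correct on `J` too. Without pulls, only duels involving `i` tell `I` from `J`, and each carries
relative entropy at most `5 * x ^ 2`, since all entries stay in `[1/8, 7/8]` (`bernoulli_kl_le`).

The output `I.pos` has probability at least `1 - δ` under `I`, provided the expected number of duels
is finite, and at most `δ` under `J`. A change of measure then forces `5 * x ^ 2` times the expected
number of duels of `i` to be at least `(1 - 2δ) log ((1 - δ) / δ) ≥ log (1 / (2δ))`. Instead of
likelihood ratios of whole runs, it uses a backward recursion (`value`) with one Bernoulli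
Donsker-Varadhan inequality per round (`log_mul_value_le`).

Summing over `i` and counting each duel at most twice costs a factor 2, so the constant is `1 / (5 *
2) = 1/10`. -/

open scoped NNReal

/-! ### Resampling in product measures, and Bernoulli integrals. -/

/-- Overwriting the coordinates in `S` of one sample of a product measure by those of an independent
sample yields again a sample of that product measure. -/
theorem measurePreserving_piecewise_infinitePi {ι : Type*} {X : ι → Type*}
    [∀ i, MeasurableSpace (X i)] (ν : ∀ i, Measure (X i)) [∀ i, IsProbabilityMeasure (ν i)]
    (S : Set ι) [DecidablePred (· ∈ S)] :
    MeasurePreserving (fun z : (∀ i, X i) × (∀ i, X i) => S.piecewise z.2 z.1)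
      ((Measure.infinitePi ν).prod (Measure.infinitePi ν)) (Measure.infinitePi ν) := by
  have hm : Measurable (fun z : (∀ i, X i) × (∀ i, X i) => S.piecewise z.2 z.1) := by
    refine measurable_pi_lambda _ fun i => ?_
    by_cases hi : i ∈ S
    · simp only [Set.piecewise, hi, if_true]; fun_prop
    · simp only [Set.piecewise, hi, if_false]; fun_prop
  refine ⟨hm, Measure.eq_infinitePi ν fun s t ht => ?_⟩
  have hpre : (fun z : (∀ i, X i) × (∀ i, X i) => S.piecewise z.2 z.1) ⁻¹' (Set.pi s t) =
      (Set.pi (↑(s.filter fun i => ¬ i ∈ S)) t) ×ˢ (Set.pi (↑(s.filter fun i => i ∈ S)) t) := by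
    ext z
    simp only [Set.mem_preimage, Set.mem_pi, Set.mem_prod, Finset.coe_filter, Set.mem_ofPred_eq,
      Set.piecewise, SetLike.mem_coe]
    constructor
    · intro h
      exact ⟨fun i hi => by simpa [hi.2] using h i hi.1, fun i hi => by simpa [hi.2] using h i hi.1⟩
    · rintro ⟨h1, h2⟩ i hi
      by_cases hS : i ∈ S
      · simpa [hS] using h2 i ⟨hi, hS⟩
      · simpa [hS] using h1 i ⟨hi, hS⟩
  rw [Measure.map_apply hm (MeasurableSet.pi s.countable_toSet fun i _ => ht i), hpre,
    Measure.prod_prod, Measure.infinitePi_pi ν fun i _ => ht i,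
    Measure.infinitePi_pi ν fun i _ => ht i, mul_comm,
    Finset.prod_filter_mul_prod_filter_not s (fun i => i ∈ S)]

theorem lintegral_bernoulliMeasure_one_zero (p : unitInterval) (f : ℝ → ℝ≥0∞)
    (hf : Measurable f) :
    ∫⁻ y, f y ∂(bernoulliMeasure (1 : ℝ) 0 p) =
      (unitInterval.toNNReal p : ℝ≥0∞) * f 1 +
        (unitInterval.toNNReal (unitInterval.symm p) : ℝ≥0∞) * f 0 := by
  rw [bernoulliMeasure_def, lintegral_add_measure, lintegral_smul_measure, lintegral_smul_measure,
    lintegral_dirac' _ hf, lintegral_dirac' _ hf]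
  rfl

/-! ### Measurability of runs, and their dependence on past answers only. -/

namespace TBPDC

instance {K : ℕ} : MeasurableSpace (Decision K) := ⊤

instance {K : ℕ} : Countable (Query K) := by
  refine Function.Injective.countable (β := Fin K ⊕ Fin K × Fin K)
    (f := fun q => match q with
      | .pull i => .inl i
      | .duel i j => .inr (i, j)) ?_
  rintro (_ | _) (_ | _) h <;> simp_all

instance {K : ℕ} : Countable (Decision K) := by
  refine Function.Injective.countable (β := Query K ⊕ Finset (Fin K))
    (f := fun d => match d with
      | .query q => .inl q
      | .halt S => .inr S) ?_
  rintro (_ | _) (_ | _) h <;> simp_all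

instance {K : ℕ} : DiscreteMeasurableSpace (Decision K) := ⟨fun _ => trivial⟩

namespace Decision

variable {K : ℕ}

/-- The entry of the history that is due to a decision in round `t`. -/
def answer (t : ℕ) (ω : ℕ × Query K → ℝ) : Decision K → ℝ
  | .query q => ω (t, q)
  | .halt _ => 0

/-- The mean of a quantity after a decision: it is `a` if the first arm of a duel wins, `b` if the
second one does, and `0` after all other decisions. -/
noncomputable def mean (M : Fin K → Fin K → unitInterval) (a b : ℝ≥0) : Decision K → ℝ≥0
  | .query (.duel i j) =>
    unitInterval.toNNReal (M i j) * a + unitInterval.toNNReal (unitInterval.symm (M i j)) * b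
  | _ => 0

theorem measurable_answer (t : ℕ) :
    Measurable fun z : Decision K × (ℕ × Query K → ℝ) => z.1.answer t z.2 := by
  refine measurable_from_prod_countable_right fun d => ?_
  cases d with
  | query q => exact measurable_pi_apply _
  | halt S => exact measurable_const

theorem measurable_mean (M : Fin K → Fin K → unitInterval) :
    Measurable fun z : Decision K × (ℝ≥0 × ℝ≥0) => z.1.mean M z.2.1 z.2.2 := by
  refine measurable_from_prod_countable_right fun d => ?_
  rcases d with (_ | ⟨i, j⟩) | _
  · exact measurable_const
  · simp only [mean]; fun_prop
  · exact measurable_const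

end Decision

namespace Algorithm

variable {K : ℕ} {Ξ : Type*} [MeasurableSpace Ξ]

theorem measurable_next' (A : Algorithm K Ξ) (t : ℕ) : Measurable (A.next t) :=
  measurable_to_countable' fun d => A.measurable_next t d

theorem history_succ (A : Algorithm K Ξ) (x : Ξ × (ℕ × Query K → ℝ)) (t : ℕ) :
    A.history x (t + 1) =
      Fin.snoc (α := fun _ => ℝ) (A.history x t) ((A.decision x t).answer t x.2) := by
  rw [history, decision]
  cases A.next t (x.1, A.history x t) <;> rfl

theorem reaches_zero (A : Algorithm K Ξ) (x : Ξ × (ℕ × Query K → ℝ)) : A.Reaches x 0 :=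
  fun s hs => absurd hs (Nat.not_lt_zero s)

theorem reaches_succ (A : Algorithm K Ξ) (x : Ξ × (ℕ × Query K → ℝ)) (t : ℕ) :
    A.Reaches x (t + 1) ↔ A.Reaches x t ∧ ∀ S, A.decision x t ≠ .halt S := by
  constructor
  · exact fun h => ⟨fun s hs => h s (by omega), h t (by omega)⟩
  · rintro ⟨h1, h2⟩ s hs
    rcases Nat.lt_succ_iff_lt_or_eq.mp hs with h | rfl
    · exact h1 s h
    · exact h2

theorem measurable_fin_snoc (t : ℕ) :
    Measurable fun z : (Fin t → ℝ) × ℝ => (Fin.snoc (α := fun _ => ℝ) z.1 z.2 : Fin (t + 1) → ℝ) := by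
  refine measurable_pi_lambda _ fun i => ?_
  refine Fin.lastCases ?_ (fun j => ?_) i
  · simp only [Fin.snoc_last]; fun_prop
  · simp only [Fin.snoc_castSucc]; fun_prop

theorem measurable_history (A : Algorithm K Ξ) (t : ℕ) :
    Measurable fun x : Ξ × (ℕ × Query K → ℝ) => A.history x t := by
  induction t with
  | zero => exact measurable_pi_lambda _ fun i => i.elim0
  | succ t ih =>
    simp only [history_succ]
    have hd : Measurable fun x : Ξ × (ℕ × Query K → ℝ) => A.decision x t :=
      (A.measurable_next' t).comp (measurable_fst.prodMk ih)
    exact (measurable_fin_snoc t).comp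
      (ih.prodMk ((Decision.measurable_answer t).comp (hd.prodMk measurable_snd)))

theorem measurable_decision (A : Algorithm K Ξ) (t : ℕ) :
    Measurable fun x : Ξ × (ℕ × Query K → ℝ) => A.decision x t :=
  (A.measurable_next' t).comp (measurable_fst.prodMk (A.measurable_history t))

theorem measurableSet_reaches (A : Algorithm K Ξ) (t : ℕ) :
    MeasurableSet {x : Ξ × (ℕ × Query K → ℝ) | A.Reaches x t} := by
  simp only [Reaches, Set.ofPred_forall]
  exact MeasurableSet.iInter fun s => MeasurableSet.iInter fun _ => MeasurableSet.iInter fun S =>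
    (A.measurable_decision s (MeasurableSet.of_discrete (s := {Decision.halt S}))).compl

/-- The history before round `t` does not depend on the answers in later rounds. -/
theorem history_congr (A : Algorithm K Ξ) {ξ : Ξ} {ω ω' : ℕ × Query K → ℝ} (t : ℕ)
    (h : ∀ s < t, ∀ q, ω (s, q) = ω' (s, q)) : A.history (ξ, ω) t = A.history (ξ, ω') t := by
  induction t with
  | zero => rfl
  | succ t ih =>
    have ih' := ih fun s hs => h s (by omega)
    have hd : A.decision (ξ, ω) t = A.decision (ξ, ω') t := by simp only [decision, ih']
    rw [history_succ, history_succ, ih', hd]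
    congr 1
    cases A.decision (ξ, ω') t with
    | query q => exact h t (by omega) q
    | halt S => rfl

theorem decision_congr (A : Algorithm K Ξ) {ξ : Ξ} {ω ω' : ℕ × Query K → ℝ} (t : ℕ)
    (h : ∀ s < t, ∀ q, ω (s, q) = ω' (s, q)) : A.decision (ξ, ω) t = A.decision (ξ, ω') t := by
  simp only [decision, A.history_congr t h]

theorem reaches_congr (A : Algorithm K Ξ) {ξ : Ξ} {ω ω' : ℕ × Query K → ℝ} (t : ℕ)
    (h : ∀ s < t, ∀ q, ω (s, q) = ω' (s, q)) : A.Reaches (ξ, ω) t ↔ A.Reaches (ξ, ω') t := by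
  refine forall_congr' fun s => forall_congr' fun hs => ?_
  rw [A.decision_congr s fun r hr => h r (by omega)]

/-! ### Mean payoffs by backward recursion. -/

/-- The mean total payoff of the next `m` rounds before termination, given the seed and the answers
before round `t`, when a decision `d` pays `g d` and no pull is ever made. -/
noncomputable def value (A : Algorithm K Ξ) (M : Fin K → Fin K → unitInterval)
    (g : Decision K → ℝ≥0) : ℕ → (t : ℕ) → Ξ × (Fin t → ℝ) → ℝ≥0
  | 0, _, _ => 0
  | m + 1, t, x => g (A.next t x) + (A.next t x).mean M
      (value A M g m (t + 1) (x.1, Fin.snoc (α := fun _ => ℝ) x.2 1))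
      (value A M g m (t + 1) (x.1, Fin.snoc (α := fun _ => ℝ) x.2 0))

theorem measurable_value (A : Algorithm K Ξ) (M : Fin K → Fin K → unitInterval)
    (g : Decision K → ℝ≥0) (m : ℕ) : ∀ t, Measurable (A.value M g m t) := by
  induction m with
  | zero => exact fun t => measurable_const
  | succ m ih =>
    intro t
    have hs : ∀ y : ℝ, Measurable fun x : Ξ × (Fin t → ℝ) =>
        A.value M g m (t + 1) (x.1, Fin.snoc (α := fun _ => ℝ) x.2 y) := fun y =>
      (ih (t + 1)).comp (measurable_fst.prodMk
        ((measurable_fin_snoc t).comp (measurable_snd.prodMk measurable_const)))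
    exact ((measurable_of_countable g).comp (A.measurable_next' t)).add
      ((Decision.measurable_mean M).comp ((A.measurable_next' t).prodMk ((hs 1).prodMk (hs 0))))

open Classical in
/-- The payoff in round `t` if a decision `d` pays `g d` until termination. -/
noncomputable def payoff (A : Algorithm K Ξ) (g : Decision K → ℝ≥0) (t : ℕ)
    (x : Ξ × (ℕ × Query K → ℝ)) : ℝ≥0∞ :=
  if A.Reaches x t then g (A.decision x t) else 0

theorem measurable_payoff (A : Algorithm K Ξ) (g : Decision K → ℝ≥0) (t : ℕ) :
    Measurable (A.payoff g t) :=
  Measurable.ite (A.measurableSet_reaches t)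
    (((measurable_of_countable g).comp (A.measurable_decision t)).coe_nnreal_ennreal)
    measurable_const

variable {τ : ℝ}

/-- The answers in round `t` may be replaced by an independent sample. -/
theorem lintegral_runLaw_resample (I : Problem K τ) (R : ℝ) (ρ : Measure Ξ)
    [IsProbabilityMeasure ρ] (t : ℕ) (f : Ξ × (ℕ × Query K → ℝ) → ℝ≥0∞) (hf : Measurable f) :
    ∫⁻ x, f x ∂(I.runLaw R ρ) =
      ∫⁻ x, ∫⁻ η, f (x.1, ({s | s.1 = t} : Set (ℕ × Query K)).piecewise η x.2)
        ∂(Measure.infinitePi fun tq : ℕ × Query K => I.answerLaw R tq.2) ∂(I.runLaw R ρ) := by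
  have hp := measurePreserving_piecewise_infinitePi
    (fun tq : ℕ × Query K => I.answerLaw R tq.2) {s | s.1 = t}
  have hg : Measurable fun z : (Ξ × (ℕ × Query K → ℝ)) × (ℕ × Query K → ℝ) =>
      f (z.1.1, ({s | s.1 = t} : Set (ℕ × Query K)).piecewise z.2 z.1.2) :=
    hf.comp ((measurable_fst.comp measurable_fst).prodMk (hp.measurable.comp
      ((measurable_snd.comp measurable_fst).prodMk measurable_snd)))
  unfold Problem.runLaw
  rw [lintegral_prod _ hf.aemeasurable, lintegral_prod _ hg.lintegral_prod_right'.aemeasurable]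
  refine lintegral_congr fun ξ => ?_
  have hfξ : Measurable fun ω => f (ξ, ω) := hf.comp measurable_prodMk_left
  rw [← hp.lintegral_comp hfξ]
  exact lintegral_prod _ (hfξ.comp hp.measurable).aemeasurable

-- This ties the recursion to actual runs: induction on the horizon `m`, where the first of the `m +
-- 1` rounds is paid directly and its answer is then integrated out.
open Classical in
theorem lintegral_value (A : Algorithm K Ξ) (hA : A.UsesOnlyDuels) (I : Problem K τ) (R : ℝ)
    (ρ : Measure Ξ) [IsProbabilityMeasure ρ] (g : Decision K → ℝ≥0) (m : ℕ) : ∀ t,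
    ∫⁻ x, (if A.Reaches x t then (A.value I.M g m t (x.1, A.history x t) : ℝ≥0∞) else 0)
        ∂(I.runLaw R ρ) =
      ∑ s ∈ Finset.range m, ∫⁻ x, A.payoff g (t + s) x ∂(I.runLaw R ρ) := by
  induction m with
  | zero => intro t; simp [value]
  | succ m ih =>
    intro t
    have hm : Measurable fun x : Ξ × (ℕ × Query K → ℝ) =>
        if A.Reaches x (t + 1) then
          (A.value I.M g m (t + 1) (x.1, A.history x (t + 1)) : ℝ≥0∞) else 0 :=
      Measurable.ite (A.measurableSet_reaches (t + 1))
        ((A.measurable_value I.M g m (t + 1)).comp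
          (measurable_fst.prodMk (A.measurable_history (t + 1)))).coe_nnreal_ennreal
        measurable_const
    have ih' := ih (t + 1)
    simp only [add_right_comm t 1, add_assoc t _ 1] at ih'
    rw [Finset.sum_range_succ', add_zero, add_comm (Finset.sum _ _), ← ih', lintegral_runLaw_resample I R ρ t _ hm,
      ← lintegral_add_left (A.measurable_payoff g t)]
    refine lintegral_congr fun x => ?_
    obtain ⟨ξ, ω⟩ := x
    -- Whether round `t` is reached, and the history and decision there, are unaffected by
    -- resampling that round. Hence the inner integral is over one fresh answer.
    have hpre : ∀ η : ℕ × Query K → ℝ, ∀ s < t, ∀ q,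
        ({s | s.1 = t} : Set (ℕ × Query K)).piecewise η ω (s, q) = ω (s, q) := by
      intro η s hs q
      simp [Set.piecewise, hs.ne]
    simp only [history_succ, reaches_succ, A.reaches_congr t (hpre _), A.history_congr t (hpre _),
      A.decision_congr t (hpre _), payoff]
    by_cases hr : A.Reaches (ξ, ω) t
    swap
    · simp [hr]
    have hval : (A.value I.M g (m + 1) t (ξ, A.history (ξ, ω) t) : ℝ≥0∞) =
        g (A.decision (ξ, ω) t) + ((A.decision (ξ, ω) t).mean I.M
          (A.value I.M g m (t + 1) (ξ, Fin.snoc (α := fun _ => ℝ) (A.history (ξ, ω) t) 1))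
          (A.value I.M g m (t + 1) (ξ, Fin.snoc (α := fun _ => ℝ) (A.history (ξ, ω) t) 0)) :
            ℝ≥0) := by
      rw [← ENNReal.coe_add]; rfl
    simp only [hr, if_true, true_and, hval]
    congr 1
    have hnp : ∀ i, A.decision (ξ, ω) t ≠ .query (.pull i) := fun i => hA t _ i
    rcases hd : A.decision (ξ, ω) t with (i | ⟨i, j⟩) | S
    · exact absurd hd (hnp i)
    · have hv : Measurable fun y : ℝ => (A.value I.M g m (t + 1)
          (ξ, Fin.snoc (α := fun _ => ℝ) (A.history (ξ, ω) t) y) : ℝ≥0∞) :=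
        ((A.measurable_value I.M g m (t + 1)).comp (measurable_const.prodMk
          ((measurable_fin_snoc t).comp
            (measurable_const.prodMk measurable_id)))).coe_nnreal_ennreal
      have := lintegral_bernoulliMeasure_one_zero (I.M i j) _ hv
      have he := (measurePreserving_eval_infinitePi
        (fun tq : ℕ × Query K => I.answerLaw R tq.2) (t, .duel i j)).lintegral_comp hv
      rw [Decision.mean, ENNReal.coe_add, ENNReal.coe_mul, ENNReal.coe_mul, ← this]
      refine Eq.trans he.symm (lintegral_congr fun η => ?_)
      simp [Decision.answer, Set.piecewise]
    · simp [Decision.mean]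

end Algorithm
end TBPDC

/-! ### Scalar inequalities for Bernoulli laws. -/

/-- As a function of `q`, the difference of the two sides is monotone on `[1/8, p]` and vanishes at
`q = p`. The constant 5 works because `y * (1 - y) ≥ 7/64 > 1/10` on `[1/8, 5/8]`. -/
theorem bernoulli_kl_le_of_le {p q : ℝ} (hp : p ≤ 5 / 8) (hq : 1 / 8 ≤ q) (hqp : q ≤ p) :
    p * Real.log (p / q) + (1 - p) * Real.log ((1 - p) / (1 - q)) ≤ 5 * (p - q) ^ 2 := by
  have hd : ∀ y ∈ Set.Icc (1 / 8) p, HasDerivAt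
      (fun y => 5 * (p - y) ^ 2 + p * Real.log y + (1 - p) * Real.log (1 - y))
      (5 * (2 * (p - y) * (-1)) + p * y⁻¹ + (1 - p) * (-1 / (1 - y))) y := by
    rintro y ⟨h1, h2⟩
    have h3 : HasDerivAt (fun y : ℝ => p - y) (-1) y := by
      simpa using (hasDerivAt_id y).const_sub p
    have h4 : HasDerivAt (fun y : ℝ => 1 - y) (-1) y := by
      simpa using (hasDerivAt_id y).const_sub 1
    have h5 := ((h3.fun_pow 2).const_mul 5).fun_add
      ((Real.hasDerivAt_log (by linarith : y ≠ 0)).const_mul p)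
    exact (h5.fun_add ((h4.log (by linarith : 1 - y ≠ 0)).const_mul (1 - p))).congr_deriv
      (by norm_num)
  have hanti : AntitoneOn
      (fun y => 5 * (p - y) ^ 2 + p * Real.log y + (1 - p) * Real.log (1 - y))
      (Set.Icc (1 / 8) p) := by
    refine antitoneOn_of_deriv_nonpos (convex_Icc _ _)
      (fun y hy => (hd y hy).continuousAt.continuousWithinAt)
      (fun y hy => (hd y (interior_subset hy)).differentiableAt.differentiableWithinAt)
      fun y hy => ?_
    rw [(hd y (interior_subset hy)).deriv]
    obtain ⟨h1, h2⟩ := interior_subset hy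
    have hy0 : 0 < y := by linarith
    have hy1 : 0 < 1 - y := by linarith
    have : 5 * (2 * (p - y) * (-1)) + p * y⁻¹ + (1 - p) * (-1 / (1 - y)) =
        (p - y) * (1 - 10 * (y * (1 - y))) / (y * (1 - y)) := by
      field_simp
      ring
    rw [this]
    refine div_nonpos_of_nonpos_of_nonneg (mul_nonpos_of_nonneg_of_nonpos (by linarith) ?_)
      (by positivity)
    nlinarith
  have h := hanti (Set.mem_Icc.mpr ⟨hq, hqp⟩) (Set.mem_Icc.mpr ⟨hq.trans hqp, le_rfl⟩) hqp
  simp only [sub_self] at h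
  rw [Real.log_div (by linarith) (by linarith), Real.log_div (by linarith) (by linarith)]
  nlinarith

/-- The relative entropy of two Bernoulli laws is at most five times the squared difference of
their parameters, if these are not too close to `0` and `1`. -/
theorem bernoulli_kl_le {p q : ℝ} (hp : 3 / 8 ≤ p) (hp' : p ≤ 5 / 8) (hq : 1 / 8 ≤ q)
    (hq' : q ≤ 7 / 8) :
    p * Real.log (p / q) + (1 - p) * Real.log ((1 - p) / (1 - q)) ≤ 5 * (p - q) ^ 2 := by
  rcases le_total q p with h | h
  · exact bernoulli_kl_le_of_le hp' hq h
  · have := bernoulli_kl_le_of_le (p := 1 - p) (q := 1 - q) (by linarith) (by linarith)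
      (by linarith)
    simp only [sub_sub_cancel] at this
    nlinarith

/-- The Donsker-Varadhan inequality for Bernoulli laws. -/
theorem bernoulli_donsker_varadhan {p q a b : ℝ} (hp : 0 < p) (hp' : p < 1) (hq : 0 < q)
    (hq' : q < 1) (ha : 0 < a) (hb : 0 < b) :
    p * Real.log a + (1 - p) * Real.log b ≤ Real.log (q * a + (1 - q) * b) +
      (p * Real.log (p / q) + (1 - p) * Real.log ((1 - p) / (1 - q))) := by
  have h1p : 0 < 1 - p := by linarith
  have h1q : 0 < 1 - q := by linarith
  have hz : 0 < q * a + (1 - q) * b := by positivity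
  set z := q * a + (1 - q) * b with hzdef
  -- Gibbs' inequality against the tilted law with weights `q * a / z` and `(1 - q) * b / z`: these
  -- sum to 1, so the weighted right-hand sides cancel (`h5`).
  have h1 := Real.log_le_sub_one_of_pos (show 0 < a * q / (p * z) by positivity)
  have h2 := Real.log_le_sub_one_of_pos (show 0 < b * (1 - q) / ((1 - p) * z) by positivity)
  rw [Real.log_div (by positivity) (by positivity), Real.log_mul (by positivity) (by positivity),
    Real.log_mul (by positivity) (by positivity)] at h1 h2
  have h3 := mul_le_mul_of_nonneg_left h1 hp.le
  have h4 := mul_le_mul_of_nonneg_left h2 h1p.le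
  have h5 : p * (a * q / (p * z) - 1) + (1 - p) * (b * (1 - q) / ((1 - p) * z) - 1) = 0 := by
    have : p * (a * q / (p * z) - 1) + (1 - p) * (b * (1 - q) / ((1 - p) * z) - 1) =
        (q * a + (1 - q) * b) / z - 1 := by
      field_simp
      ring
    rw [this, ← hzdef, div_self hz.ne', sub_self]
  rw [Real.log_div (by positivity) (by positivity), Real.log_div (by positivity) (by positivity)]
  nlinarith

/-- The relative entropy of the Bernoulli laws with parameters `1 - δ` and `δ` is at least
`log (1 / (2 δ))`. -/
theorem log_one_div_two_mul_le {δ : ℝ} (h0 : 0 < δ) (h1 : δ ≤ 0.15) :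
    Real.log (1 / (2 * δ)) ≤ (1 - 2 * δ) * Real.log ((1 - δ) / δ) := by
  norm_num at h1
  have hd1 : 0 < 1 - δ := by linarith
  -- Bounding both logarithms from their values at `δ = 3/20` leaves an affine function of `δ`. It
  -- is nonnegative at `3/20` by `hc` and nonincreasing by `hd`, hence nonnegative for all smaller
  -- `δ`.
  have ha := Real.log_le_sub_one_of_pos (show 0 < (3 / 20) / δ by positivity)
  have hb := Real.log_le_sub_one_of_pos (show 0 < (17 / 20) / (1 - δ) by positivity)
  rw [Real.log_div (by norm_num) (by positivity)] at ha hb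
  have hc : 0 ≤ 3 * Real.log (3 / 20) + 7 * Real.log (17 / 20) + 10 * Real.log 2 := by
    have : 3 * Real.log (3 / 20) + 7 * Real.log (17 / 20) + 10 * Real.log 2 =
        Real.log ((3 / 20) ^ 3 * (17 / 20) ^ 7 * 2 ^ 10) := by
      rw [Real.log_mul (by norm_num) (by norm_num), Real.log_mul (by norm_num) (by norm_num),
        Real.log_pow, Real.log_pow, Real.log_pow]
      norm_num
    rw [this]
    exact Real.log_nonneg (by norm_num)
  have hd : Real.log (3 / 20) - Real.log (17 / 20) + 1 ≤ 0 := by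
    rw [← Real.log_div (by norm_num) (by norm_num), ← le_neg_iff_add_nonpos_right,
      Real.log_le_iff_le_exp (by norm_num), Real.exp_neg, le_inv_comm₀ (by norm_num)
        (Real.exp_pos 1)]
    exact Real.exp_one_lt_d9.le.trans (by norm_num)
  have ha' := mul_le_mul_of_nonneg_left ha (show 0 ≤ 2 * δ by linarith)
  have hb' := mul_le_mul_of_nonneg_left hb (show 0 ≤ 1 - 2 * δ by linarith)
  have e1 : 2 * δ * (3 / 20 / δ - 1) = 3 / 10 - 2 * δ := by
    field_simp
    ring
  have e2 : (1 - 2 * δ) * (17 / 20 / (1 - δ) - 1) ≤ 0 := by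
    refine mul_nonpos_of_nonneg_of_nonpos (by linarith) ?_
    rw [sub_nonpos, div_le_one hd1]
    linarith
  rw [e1] at ha'
  rw [one_div, Real.log_inv, Real.log_mul (by norm_num) h0.ne', Real.log_div hd1.ne' h0.ne']
  nlinarith [mul_nonneg (sub_nonneg.mpr h1) (neg_nonneg.mpr hd)]

/-! ### Change of measure along a run. -/

namespace TBPDC

namespace Decision

variable {K : ℕ}

/-- The indicator of halting with output `S`. -/
def haltsWith (S : Finset (Fin K)) : Decision K → ℝ≥0
  | .query _ => 0
  | .halt S' => if S' = S then 1 else 0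

/-- The indicator of a duel in which arm `i` takes part. -/
def duelsArm (i : Fin K) : Decision K → ℝ≥0
  | .query (.duel a b) => if a = i ∨ b = i then 1 else 0
  | _ => 0

theorem coe_mean_duel (M : Fin K → Fin K → unitInterval) (i j : Fin K) (a b : ℝ≥0) :
    ((Decision.query (.duel i j)).mean M a b : ℝ) = M i j * a + (1 - M i j) * b := by
  simp [mean]

end Decision

namespace Algorithm

variable {K : ℕ} {Ξ : Type*} [MeasurableSpace Ξ]

/-- Change of measure: the chance of the output `S` under `M` is controlled by that under `N` and
by the mean number of duels in which the laws differ. -/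
theorem log_mul_value_le (A : Algorithm K Ξ) (M N : Fin K → Fin K → unitInterval)
    (S : Finset (Fin K)) (i : Fin K) (κ : ℝ≥0) (c : ℝ) (hc : 0 ≤ c)
    (hM : ∀ a b, 3 / 8 ≤ (M a b : ℝ) ∧ (M a b : ℝ) ≤ 5 / 8)
    (hN : ∀ a b, 1 / 8 ≤ (N a b : ℝ) ∧ (N a b : ℝ) ≤ 7 / 8)
    (hMN : ∀ a b, 5 * ((M a b : ℝ) - N a b) ^ 2 ≤ if a = i ∨ b = i then (κ : ℝ) else 0) (m : ℕ) :
    ∀ t x, Real.log (1 + c) * A.value M (Decision.haltsWith S) m t x ≤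
      Real.log (1 + c * A.value N (Decision.haltsWith S) m t x) +
        A.value M (fun d => κ * Decision.duelsArm i d) m t x := by
  induction m with
  | zero => intro t x; simp [value]
  | succ m ih =>
    intro t x
    simp only [value, NNReal.coe_add]
    rcases hd : A.next t x with (a | ⟨a, b⟩) | S'
    -- After a pull `mean` is 0 by convention, so both sides vanish.
    · simp [Decision.haltsWith, Decision.mean, Decision.duelsArm]
    · have ih1 := ih (t + 1) (x.1, Fin.snoc (α := fun _ => ℝ) x.2 1)
      have ih0 := ih (t + 1) (x.1, Fin.snoc (α := fun _ => ℝ) x.2 0)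
      set w1 := A.value M (Decision.haltsWith S) m (t + 1)
        (x.1, Fin.snoc (α := fun _ => ℝ) x.2 1)
      set w0 := A.value M (Decision.haltsWith S) m (t + 1)
        (x.1, Fin.snoc (α := fun _ => ℝ) x.2 0)
      set v1 := A.value N (Decision.haltsWith S) m (t + 1)
        (x.1, Fin.snoc (α := fun _ => ℝ) x.2 1)
      set v0 := A.value N (Decision.haltsWith S) m (t + 1)
        (x.1, Fin.snoc (α := fun _ => ℝ) x.2 0)
      set k1 := A.value M (fun d => κ * Decision.duelsArm i d) m (t + 1)
        (x.1, Fin.snoc (α := fun _ => ℝ) x.2 1)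
      set k0 := A.value M (fun d => κ * Decision.duelsArm i d) m (t + 1)
        (x.1, Fin.snoc (α := fun _ => ℝ) x.2 0)
      simp only [Decision.coe_mean_duel]
      simp only [Decision.haltsWith, Decision.duelsArm]
      obtain ⟨hp, hp'⟩ := hM a b
      obtain ⟨hq, hq'⟩ := hN a b
      -- Since `1 + c * v` is affine in `v`, its `N`-mean over the two answers is again of this form
      -- with the value one round earlier. This lets the inequality pass through the recursion.
      have hdv := bernoulli_donsker_varadhan (p := M a b) (q := N a b) (a := 1 + c * v1)
        (b := 1 + c * v0) (by linarith) (by linarith) (by linarith) (by linarith)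
        (by positivity) (by positivity)
      have hkl := bernoulli_kl_le hp hp' hq hq'
      have hcost : ((κ * (if a = i ∨ b = i then 1 else 0) : ℝ≥0) : ℝ) =
          if a = i ∨ b = i then (κ : ℝ) else 0 := by
        split_ifs <;> simp
      have h1 := mul_le_mul_of_nonneg_left ih1 (show (0 : ℝ) ≤ M a b by linarith)
      have h0 := mul_le_mul_of_nonneg_left ih0 (show (0 : ℝ) ≤ 1 - M a b by linarith)
      have harg : 1 + c * (((0 : ℝ≥0) : ℝ) + ((N a b : ℝ) * v1 + (1 - N a b) * v0)) =
          N a b * (1 + c * v1) + (1 - N a b) * (1 + c * v0) := by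
        simp only [NNReal.coe_zero]; ring
      rw [harg, hcost, NNReal.coe_zero]
      linarith [hMN a b]
    -- Halting with `S` gives equality: both sides are `log (1 + c)`.
    · by_cases hS : S' = S
      · simp [Decision.haltsWith, Decision.mean, Decision.duelsArm, hS]
      · simp [Decision.haltsWith, Decision.mean, Decision.duelsArm, hS]

variable {τ : ℝ}

theorem lintegral_value_zero (A : Algorithm K Ξ) (hA : A.UsesOnlyDuels) (I : Problem K τ) (R : ℝ)
    (ρ : Measure Ξ) [IsProbabilityMeasure ρ] (g : Decision K → ℝ≥0) (m : ℕ) :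
    ∫⁻ ξ, (A.value I.M g m 0 (ξ, Fin.elim0) : ℝ≥0∞) ∂ρ =
      ∑ s ∈ Finset.range m, ∫⁻ x, A.payoff g s x ∂(I.runLaw R ρ) := by
  have h := A.lintegral_value hA I R ρ g m 0
  simp only [reaches_zero, if_true, zero_add] at h
  rw [← h, Problem.runLaw, lintegral_prod]
  · refine lintegral_congr fun ξ => ?_
    simp [history]
  · exact (((A.measurable_value I.M g m 0).comp (measurable_fst.prodMk
      (A.measurable_history 0))).coe_nnreal_ennreal).aemeasurable

theorem payoff_const_mul (A : Algorithm K Ξ) (κ : ℝ≥0) (g : Decision K → ℝ≥0) (t : ℕ)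
    (x : Ξ × (ℕ × Query K → ℝ)) : A.payoff (fun d => κ * g d) t x = κ * A.payoff g t x := by
  simp only [payoff]
  split_ifs <;> simp

/-- The transportation inequality for the first `m` rounds. -/
theorem sum_payoff_haltsWith_le (A : Algorithm K Ξ) (hA : A.UsesOnlyDuels) (I J : Problem K τ)
    (R : ℝ) (ρ : Measure Ξ) [IsProbabilityMeasure ρ] (S : Finset (Fin K)) (i : Fin K) (κ : ℝ≥0)
    (hM : ∀ a b, 3 / 8 ≤ (I.M a b : ℝ) ∧ (I.M a b : ℝ) ≤ 5 / 8)
    (hN : ∀ a b, 1 / 8 ≤ (J.M a b : ℝ) ∧ (J.M a b : ℝ) ≤ 7 / 8)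
    (hMN : ∀ a b, 5 * ((I.M a b : ℝ) - J.M a b) ^ 2 ≤ if a = i ∨ b = i then (κ : ℝ) else 0)
    (m : ℕ) {δ : ℝ} (h0 : 0 < δ) (h1 : δ < 1 / 2)
    (hδ : ∑ s ∈ Finset.range m, ∫⁻ x, A.payoff (Decision.haltsWith S) s x ∂(J.runLaw R ρ) ≤
      ENNReal.ofReal δ) :
    ENNReal.ofReal (2 * Real.log ((1 - δ) / δ)) *
        ∑ s ∈ Finset.range m, ∫⁻ x, A.payoff (Decision.haltsWith S) s x ∂(I.runLaw R ρ) ≤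
      ENNReal.ofReal (Real.log ((1 - δ) / δ)) +
        κ * ∑ s ∈ Finset.range m, ∫⁻ x, A.payoff (Decision.duelsArm i) s x ∂(I.runLaw R ρ) := by
  -- With `c = r ^ 2 - 1` one has `1 + c = r ^ 2` and `1 + c * δ = r`, which produces the `2 * log
  -- r` and the `log r` of the conclusion.
  set r := (1 - δ) / δ with hr
  have hr1 : 1 < r := by rw [hr, one_lt_div h0]; linarith
  have hr0 : 0 < r := by linarith
  have hl : 0 < Real.log r := Real.log_pos hr1
  have hc : 0 ≤ r ^ 2 - 1 := by nlinarith
  have hpt : ∀ ξ : Ξ, ENNReal.ofReal (2 * Real.log r) *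
        (A.value I.M (Decision.haltsWith S) m 0 (ξ, Fin.elim0) : ℝ≥0∞) + 1 ≤
      (ENNReal.ofReal (1 / r + Real.log r) + ENNReal.ofReal ((r ^ 2 - 1) / r) *
        (A.value J.M (Decision.haltsWith S) m 0 (ξ, Fin.elim0) : ℝ≥0∞)) +
        (A.value I.M (fun d => κ * Decision.duelsArm i d) m 0 (ξ, Fin.elim0) : ℝ≥0∞) := by
    intro ξ
    have h := A.log_mul_value_le I.M J.M S i κ (r ^ 2 - 1) hc hM hN hMN m 0 (ξ, Fin.elim0)
    generalize A.value I.M (Decision.haltsWith S) m 0 (ξ, Fin.elim0) = w at h ⊢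
    generalize A.value J.M (Decision.haltsWith S) m 0 (ξ, Fin.elim0) = v at h ⊢
    generalize A.value I.M (fun d => κ * Decision.duelsArm i d) m 0 (ξ, Fin.elim0) = k at h ⊢
    -- The logarithm is replaced by its tangent at `r`, so that the bound is linear in `v` and can
    -- be averaged over the seed. Nothing is lost when the output probability under `J` equals `δ`.
    -- The `1` on the left of `hpt` avoids a subtraction in `ℝ≥0∞`.
    have hlog := Real.log_le_sub_one_of_pos
      (show 0 < (1 + (r ^ 2 - 1) * v) / r by positivity)
    rw [Real.log_div (by positivity) hr0.ne'] at hlog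
    rw [add_sub_cancel, Real.log_pow] at h
    push_cast at h
    rw [← ENNReal.ofReal_coe_nnreal (p := w), ← ENNReal.ofReal_coe_nnreal (p := v),
      ← ENNReal.ofReal_coe_nnreal (p := k), ← ENNReal.ofReal_one,
      ← ENNReal.ofReal_mul (by positivity), ← ENNReal.ofReal_mul (by positivity),
      ← ENNReal.ofReal_add (by positivity) (by positivity),
      ← ENNReal.ofReal_add (by positivity) (by positivity),
      ← ENNReal.ofReal_add (by positivity) (by positivity)]
    refine ENNReal.ofReal_le_ofReal ?_
    have e : (1 + (r ^ 2 - 1) * (v : ℝ)) / r = 1 / r + (r ^ 2 - 1) / r * v := by ring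
    linarith
  have hmeas : ∀ (M : Fin K → Fin K → unitInterval) (g : Decision K → ℝ≥0), Measurable fun ξ : Ξ =>
      (A.value M g m 0 (ξ, Fin.elim0) : ℝ≥0∞) := fun M g =>
    ((A.measurable_value M g m 0).comp
      (measurable_id.prodMk measurable_const)).coe_nnreal_ennreal
  have hint := lintegral_mono (μ := ρ) hpt
  rw [lintegral_add_right _ measurable_const, lintegral_add_right _ (hmeas _ _),
    lintegral_add_left measurable_const, lintegral_const_mul _ (hmeas _ _),
    lintegral_const_mul _ (hmeas _ _), lintegral_value_zero A hA I R,
    lintegral_value_zero A hA I R, lintegral_value_zero A hA J R] at hint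
  simp only [lintegral_const, measure_univ, mul_one, payoff_const_mul] at hint
  have hk : ∀ s, ∫⁻ x, (κ : ℝ≥0∞) * A.payoff (Decision.duelsArm i) s x ∂(I.runLaw R ρ) =
      κ * ∫⁻ x, A.payoff (Decision.duelsArm i) s x ∂(I.runLaw R ρ) := fun s =>
    lintegral_const_mul _ (A.measurable_payoff _ s)
  simp only [hk, ← Finset.mul_sum] at hint
  have hone : 1 / r + Real.log r + (r ^ 2 - 1) / r * δ = Real.log r + 1 := by
    have : 1 / r + (r ^ 2 - 1) / r * δ = 1 := by
      have h1δ : 1 - δ ≠ 0 := by linarith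
      rw [hr]
      field_simp
      ring
    linarith
  have hfin : ENNReal.ofReal (1 / r + Real.log r) + ENNReal.ofReal ((r ^ 2 - 1) / r) *
      ENNReal.ofReal δ = ENNReal.ofReal (Real.log r) + 1 := by
    rw [← ENNReal.ofReal_mul (by positivity), ← ENNReal.ofReal_add (by positivity) (by positivity),
      hone, ENNReal.ofReal_add hl.le zero_le_one, ENNReal.ofReal_one]
  have hint' := hint.trans (add_le_add_left (add_le_add_right (mul_le_mul_right hδ _) _) _)
  rw [hfin, add_right_comm] at hint'
  exact (ENNReal.add_le_add_iff_right ENNReal.one_ne_top).mp hint'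

end Algorithm
end TBPDC

/-! ### Instances with one label flipped. -/

namespace TBPDC

/-- All `K - 1` off-diagonal entries of row `i` change by `-x`, whereas every other row changes only
in its single entry in column `i`, by `x`. On the diagonal the two indicators cancel. -/
theorem bordaScore_perturb {K : ℕ} (hK : 1 < K) (M N : Fin K → Fin K → unitInterval) (i : Fin K)
    (x : ℝ) (hN : ∀ a b, (N a b : ℝ) =
      M a b + x * ((if b = i then 1 else 0) - if a = i then 1 else 0)) (a : Fin K) :
    bordaScore N a = bordaScore M a + if a = i then -x else x / ((K : ℝ) - 1) := by
  have hK' : (0 : ℝ) < (K : ℝ) - 1 := by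
    have : (1 : ℝ) < K := by exact_mod_cast hK
    linarith
  simp only [bordaScore, hN, Finset.sum_add_distrib, add_div, ← Finset.mul_sum,
    Finset.sum_sub_distrib]
  congr 1
  by_cases h : a = i
  · subst h
    simp only [if_true, Finset.sum_const, Finset.card_erase_of_mem (Finset.mem_univ a),
      Finset.card_univ, Fintype.card_fin, nsmul_eq_mul, mul_one, Nat.cast_sub hK.le, Nat.cast_one]
    rw [Finset.sum_eq_zero fun b hb => if_neg (Finset.ne_of_mem_erase hb)]
    field_simp
    ring
  · simp [h, Ne.symm h]

theorem bordaScore_mem_Icc {K : ℕ} (hK : 1 < K) (M : Fin K → Fin K → unitInterval)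
    (hM : ∀ a b, 3 / 8 ≤ (M a b : ℝ) ∧ (M a b : ℝ) ≤ 5 / 8) (a : Fin K) :
    3 / 8 ≤ bordaScore M a ∧ bordaScore M a ≤ 5 / 8 := by
  have hK' : (0 : ℝ) < (K : ℝ) - 1 := by
    have : (1 : ℝ) < K := by exact_mod_cast hK
    linarith
  have hcard : ((Finset.univ.erase a).card : ℝ) = (K : ℝ) - 1 := by
    simp [Finset.card_erase_of_mem, Nat.cast_sub hK.le]
  have h1 := Finset.card_nsmul_le_sum (Finset.univ.erase a) (fun b => (M a b : ℝ)) (3 / 8)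
    fun b _ => (hM a b).1
  have h2 := Finset.sum_le_card_nsmul (Finset.univ.erase a) (fun b => (M a b : ℝ)) (5 / 8)
    fun b _ => (hM a b).2
  rw [nsmul_eq_mul, hcard] at h1 h2
  rw [bordaScore, le_div_iff₀ hK', div_le_iff₀ hK']
  constructor <;> linarith

namespace Problem

variable {K : ℕ} {τ : ℝ}

theorem mem_pos {I : Problem K τ} {i : Fin K} : i ∈ I.pos ↔ τ ≤ I.μ i := by
  simp [pos]

theorem gap_nonneg (I : Problem K τ) {u l : Fin K} (hu : I.IsWorstPositive u)
    (hl : I.IsBestNegative l) (i : Fin K) : 0 ≤ I.gap u l i := by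
  unfold gap
  split_ifs with h
  · exact sub_nonneg.mpr (hu.2 i h)
  · exact sub_nonneg.mpr (hl.2 i h)

/-- Shifting the winning chances of a positive arm `i` down (of a negative arm up) by at least its
gap yields an instance in which the label of `i`, and of no other arm, is flipped. -/
theorem exists_flip (I : Problem K τ) {u l i : Fin K} (hu : I.IsWorstPositive u)
    (hl : I.IsBestNegative l) (hi : i ≠ u) (hi' : i ≠ l)
    (hM : ∀ a b, 3 / 8 ≤ (I.M a b : ℝ) ∧ (I.M a b : ℝ) ≤ 5 / 8) {x : ℝ} (hx : 0 < x)
    (hx' : x ≤ 1 / 4) (hgap : I.gap u l i ≤ x) :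
    ∃ J : Problem K τ, u ∈ J.pos ∧ l ∉ J.pos ∧ J.pos ≠ I.pos ∧
      (∀ a b, 1 / 8 ≤ (J.M a b : ℝ) ∧ (J.M a b : ℝ) ≤ 7 / 8) ∧
      ∀ a b, 5 * ((I.M a b : ℝ) - J.M a b) ^ 2 ≤ if a = i ∨ b = i then 5 * x ^ 2 else 0 := by
  classical
  have hul : u ≠ l := fun h => hl.1 (h ▸ hu.1)
  have hK : 1 < K := by
    have := Fintype.one_lt_card_iff.mpr ⟨u, l, hul⟩
    simpa using this
  have hK' : (0 : ℝ) < (K : ℝ) - 1 := by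
    have : (1 : ℝ) < K := by exact_mod_cast hK
    linarith
  obtain ⟨y, hy, hyx⟩ : ∃ y : ℝ, y ^ 2 = x ^ 2 ∧ y = if i ∈ I.pos then x else -x :=
    ⟨_, by split_ifs <;> ring, rfl⟩
  have hyabs := abs_le_of_sq_le_sq' hy.le hx.le
  have hbd : ∀ a b, 1 / 8 ≤ (I.M a b : ℝ) + y * ((if b = i then 1 else 0) - if a = i then 1 else 0) ∧
      (I.M a b : ℝ) + y * ((if b = i then 1 else 0) - if a = i then 1 else 0) ≤ 7 / 8 := by
    intro a b
    obtain ⟨h1, h2⟩ := hM a b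
    split_ifs <;> constructor <;> linarith
  let N : Fin K → Fin K → unitInterval := fun a b =>
    ⟨_, (by norm_num : (0 : ℝ) ≤ 1 / 8).trans (hbd a b).1, (hbd a b).2.trans (by norm_num)⟩
  have hN : ∀ a b, (N a b : ℝ) =
    I.M a b + y * ((if b = i then 1 else 0) - if a = i then 1 else 0) := fun a b => rfl
  -- The mean crosses the threshold; an algorithm that never pulls cannot notice this.
  let ν : Fin K → ℝ := Function.update I.μ i (if i ∈ I.pos then τ - 1 else τ)
  have hν : ∀ a, a ≠ i → ν a = I.μ a := fun a ha => Function.update_of_ne ha _ _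
  have hνi : τ ≤ ν i ↔ i ∉ I.pos := by
    simp only [ν, Function.update_self]
    split_ifs with h <;> simp [h]
  have hb := bordaScore_perturb hK I.M N i y hN
  have hup : τ ≤ ν u := by rw [hν u hi.symm]; exact mem_pos.mp hu.1
  have hlp : ¬ τ ≤ ν l := by rw [hν l hi'.symm]; exact fun h => hl.1 (mem_pos.mpr h)
  -- This is the source of strict separation. A shift by at least the gap brings `i` to the old
  -- score of `u` (or `l`) or beyond, and all other scores move the opposite way by `x / (K - 1)`.
  -- Thus `x` may equal the gap.
  have hdiv : 0 < x / ((K : ℝ) - 1) := by positivity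
  let J : Problem K τ :=
    { M := N
      μ := ν
      M_symm := fun a b => by
        rw [hN, hN, I.M_symm a b]; ring
      separated := fun a b ha hb' => by
        rw [hb a, hb b]
        rw [← not_le] at hb'
        unfold gap p at hgap
        by_cases hai : a = i
        · subst hai
          have hpos := hνi.mp ha
          have hba : b ≠ a := fun h => hb' (h ▸ ha)
          rw [hν b hba] at hb'
          have := hl.2 b fun h => hb' (mem_pos.mp h)
          simp only [hpos, if_false] at hgap hyx
          simp only [if_true, hba, if_false, hyx, neg_neg, neg_div, p] at this ⊢
          linarith
        · rw [hν a hai] at ha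
          by_cases hbi : b = i
          · subst hbi
            have hpos : b ∈ I.pos := by_contra fun h => hb' (hνi.mpr h)
            have := hu.2 a (mem_pos.mpr ha)
            simp only [hpos, if_true] at hgap hyx
            simp only [if_true, hai, if_false, hyx, p] at this ⊢
            linarith
          · rw [hν b hbi, not_le] at hb'
            simpa [hai, hbi] using I.separated a b ha hb' }
  have hJ : ∀ a, a ∈ J.pos ↔ τ ≤ ν a := fun a => mem_pos
  refine ⟨J, (hJ u).mpr hup, fun h => hlp ((hJ l).mp h), fun h => ?_, hbd, fun a b => ?_⟩
  · have := (hJ i).trans hνi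
    rw [h] at this
    tauto
  · have : (I.M a b : ℝ) - J.M a b =
        -(y * ((if b = i then 1 else 0) - if a = i then 1 else 0)) := by
      change (I.M a b : ℝ) - N a b = _
      rw [hN]; ring
    rw [this, neg_sq, mul_pow, hy]
    by_cases ha : a = i <;> by_cases hb : b = i <;> (simp [ha, hb]; try positivity)

end Problem

/-! ### Halting probabilities and duel counts. -/

namespace Algorithm

variable {K : ℕ} {Ξ : Type*} [MeasurableSpace Ξ]

/-- No round after the first halt is reached, so at most one summand is nonzero. -/
theorem sum_payoff_haltsWith_le_one (A : Algorithm K Ξ) (S : Finset (Fin K))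
    (x : Ξ × (ℕ × Query K → ℝ)) (m : ℕ) :
    ∑ s ∈ Finset.range m, A.payoff (Decision.haltsWith S) s x ≤ 1 := by
  classical
  have hz : ∀ s, A.payoff (Decision.haltsWith S) s x ≠ 0 →
      A.Reaches x s ∧ A.decision x s = .halt S := by
    intro s hs
    unfold payoff at hs
    by_cases hr : A.Reaches x s
    · refine ⟨hr, ?_⟩
      rcases hd : A.decision x s with q | S'
      · simp [hr, hd, Decision.haltsWith] at hs
      · simpa [hr, hd, Decision.haltsWith] using hs
    · simp [hr] at hs
  have hle : ∀ s, A.payoff (Decision.haltsWith S) s x ≤ 1 := by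
    intro s
    unfold payoff
    rcases A.decision x s with q | S' <;> simp only [Decision.haltsWith] <;> split_ifs <;> simp
  by_cases h : ∃ s ∈ Finset.range m, A.payoff (Decision.haltsWith S) s x ≠ 0
  · obtain ⟨s, hs, hsne⟩ := h
    obtain ⟨hr, hd⟩ := hz s hsne
    rw [Finset.sum_eq_single_of_mem s hs]
    · exact hle s
    · intro r _ hrs
      by_contra hne
      obtain ⟨hr', hd'⟩ := hz r hne
      rcases lt_or_gt_of_ne hrs with h | h
      · exact hr r h S hd'
      · exact hr' s h S hd
  · push Not at h
    rw [Finset.sum_eq_zero h]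
    exact zero_le_one

theorem payoff_haltsWith_of_not_outputs (A : Algorithm K Ξ) {S : Finset (Fin K)}
    {x : Ξ × (ℕ × Query K → ℝ)} (h : ¬ A.Outputs x S) (s : ℕ) :
    A.payoff (Decision.haltsWith S) s x = 0 := by
  classical
  unfold payoff
  split_ifs with hr
  · rcases hd : A.decision x s with q | S'
    · rfl
    · have : S' ≠ S := fun hS => h ⟨s, hr, hS ▸ hd⟩
      simp [Decision.haltsWith, this]
  · rfl

theorem one_le_tsum_payoff_haltsWith (A : Algorithm K Ξ) {S : Finset (Fin K)}
    {x : Ξ × (ℕ × Query K → ℝ)} (h : A.Outputs x S) :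
    1 ≤ ∑' s, A.payoff (Decision.haltsWith S) s x := by
  classical
  obtain ⟨t, hr, hd⟩ := h
  refine le_trans ?_ (ENNReal.le_tsum t)
  simp [payoff, hr, hd, Decision.haltsWith]

/-- The number of duels in which arm `i` takes part. -/
noncomputable def numArmDuels (A : Algorithm K Ξ) (i : Fin K) (x : Ξ × (ℕ × Query K → ℝ)) : ℝ≥0∞ :=
  ∑' s, A.payoff (Decision.duelsArm i) s x

theorem measurable_numArmDuels (A : Algorithm K Ξ) (i : Fin K) :
    Measurable (A.numArmDuels i) :=
  Measurable.tsum fun s => A.measurable_payoff _ s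

theorem sum_duelsArm_le (T : Finset (Fin K)) (a b : Fin K) :
    ∑ i ∈ T, Decision.duelsArm i (.query (.duel a b)) ≤ 2 := by
  have h : ∀ c : Fin K, ∑ i ∈ T, (if c = i then (1 : ℝ≥0) else 0) ≤ 1 := by
    intro c
    rw [Finset.sum_ite_eq]
    split_ifs <;> simp
  calc ∑ i ∈ T, Decision.duelsArm i (.query (.duel a b))
      ≤ ∑ i ∈ T, ((if a = i then (1 : ℝ≥0) else 0) + if b = i then 1 else 0) := by
        refine Finset.sum_le_sum fun i _ => ?_
        simp only [Decision.duelsArm]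
        by_cases ha : a = i <;> by_cases hb : b = i <;> simp [ha, hb]
    _ ≤ 1 + 1 := by
        rw [Finset.sum_add_distrib]
        exact add_le_add (h a) (h b)
    _ = 2 := by norm_num

/-- A duel involves at most two arms. -/
theorem sum_numArmDuels_le (A : Algorithm K Ξ) (T : Finset (Fin K))
    (x : Ξ × (ℕ × Query K → ℝ)) : ∑ i ∈ T, A.numArmDuels i x ≤ 2 * A.numDuels x := by
  classical
  unfold numArmDuels numDuels
  rw [← Summable.tsum_finsetSum fun i _ => ENNReal.summable, ← ENNReal.tsum_mul_left]
  refine ENNReal.tsum_le_tsum fun s => ?_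
  unfold payoff
  by_cases hr : A.Reaches x s
  · simp only [hr, if_true, true_and]
    rcases hd : A.decision x s with (i | ⟨a, b⟩) | S
    · simp [Decision.duelsArm]
    · have := ENNReal.coe_le_coe.mpr (sum_duelsArm_le T a b)
      rw [ENNReal.ofNNReal_finsetSum] at this
      simpa using this
    · simp [Decision.duelsArm]
  · simp [hr]

theorem numDuels_eq_top (A : Algorithm K Ξ) (hA : A.UsesOnlyDuels)
    {x : Ξ × (ℕ × Query K → ℝ)} (h : ∀ S, ¬ A.Outputs x S) : A.numDuels x = ∞ := by
  classical
  have hr : ∀ t, A.Reaches x t := by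
    intro t
    induction t with
    | zero => exact A.reaches_zero x
    | succ t ih => exact (A.reaches_succ x t).mpr ⟨ih, fun S hS => h S ⟨t, ih, hS⟩⟩
  have hd : ∀ t, ∃ i j, A.decision x t = .query (.duel i j) := by
    intro t
    rcases hd : A.decision x t with (i | ⟨a, b⟩) | S
    · exact absurd hd (hA t _ i)
    · exact ⟨a, b, rfl⟩
    · exact absurd ⟨t, hr t, hd⟩ (h S)
  simp [numDuels, hr, hd]

theorem measurable_numDuels (A : Algorithm K Ξ) : Measurable A.numDuels := by
  classical
  refine Measurable.tsum fun t => Measurable.ite ?_ measurable_const measurable_const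
  exact (A.measurableSet_reaches t).inter (A.measurable_decision t
    (MeasurableSet.of_discrete (s := {d | ∃ i j, d = Decision.query (.duel i j)})))

variable {τ : ℝ}

/-- δ-correctness only limits wrong outputs. A run that never halts makes infinitely many duels, so
a finite expectation excludes it almost surely and the remaining mass lies on the correct output. -/
theorem le_runLaw_outputs_pos (A : Algorithm K Ξ) (hA : A.UsesOnlyDuels) (ρ : Measure Ξ)
    [IsProbabilityMeasure ρ] {R δ : ℝ} (hδ : 0 ≤ δ) (I : Problem K τ) (herr : A.ErrsAtMost ρ R δ I)
    (hfin : A.expectedDuels ρ R I ≠ ∞) :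
    ENNReal.ofReal (1 - δ) ≤ I.runLaw R ρ {x | A.Outputs x I.pos} := by
  have : IsProbabilityMeasure (I.runLaw R ρ) := by unfold Problem.runLaw; infer_instance
  have hnull : I.runLaw R ρ {x | ∀ S, ¬ A.Outputs x S} = 0 :=
    measure_mono_null (fun x hx => A.numDuels_eq_top hA hx)
      (measure_eq_top_of_lintegral_ne_top A.measurable_numDuels.aemeasurable hfin)
  have hcover : (Set.univ : Set (Ξ × (ℕ × Query K → ℝ))) ⊆ {x | A.Outputs x I.pos} ∪
      ({x | ∃ S, A.Outputs x S ∧ S ≠ I.pos} ∪ {x | ∀ S, ¬ A.Outputs x S}) := by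
    intro x _
    by_cases h : ∃ S, A.Outputs x S
    · obtain ⟨S, hS⟩ := h
      by_cases hSp : S = I.pos
      · exact Or.inl (hSp ▸ hS)
      · exact Or.inr (Or.inl ⟨S, hS, hSp⟩)
    · exact Or.inr (Or.inr (not_exists.mp h))
  have h1 : 1 ≤ I.runLaw R ρ {x | A.Outputs x I.pos} + ENNReal.ofReal δ := by
    rw [← measure_univ (μ := I.runLaw R ρ)]
    refine (measure_mono hcover).trans ((measure_union_le _ _).trans (add_le_add_right ?_ _))
    refine (measure_union_le _ _).trans ?_
    rw [hnull, add_zero]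
    exact herr
  rw [ENNReal.ofReal_sub _ hδ, ENNReal.ofReal_one]
  exact tsub_le_iff_right.mpr h1

/-- The number of duels of an arm that are needed in order to determine its label. -/
theorem log_le_mul_expected_numArmDuels (A : Algorithm K Ξ) (hA : A.UsesOnlyDuels)
    (ρ : Measure Ξ) [IsProbabilityMeasure ρ] {R δ : ℝ} (h0 : 0 < δ) (h1 : δ ≤ 0.15)
    (I J : Problem K τ) (hI : A.ErrsAtMost ρ R δ I) (hJ : A.ErrsAtMost ρ R δ J)
    (hfin : A.expectedDuels ρ R I ≠ ∞) (hIJ : J.pos ≠ I.pos) (i : Fin K) (x : ℝ)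
    (hM : ∀ a b, 3 / 8 ≤ (I.M a b : ℝ) ∧ (I.M a b : ℝ) ≤ 5 / 8)
    (hN : ∀ a b, 1 / 8 ≤ (J.M a b : ℝ) ∧ (J.M a b : ℝ) ≤ 7 / 8)
    (hMN : ∀ a b, 5 * ((I.M a b : ℝ) - J.M a b) ^ 2 ≤ if a = i ∨ b = i then 5 * x ^ 2 else 0) :
    ENNReal.ofReal (Real.log (1 / (2 * δ))) ≤
      ENNReal.ofReal (5 * x ^ 2) * ∫⁻ z, A.numArmDuels i z ∂(I.runLaw R ρ) := by
  have hδ : δ < 1 / 2 := h1.trans_lt (by norm_num)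
  have hl : 0 ≤ Real.log ((1 - δ) / δ) :=
    Real.log_nonneg (by rw [one_le_div h0]; linarith)
  -- Under `J` the output `I.pos` is an error, so its probability is at most `δ`.
  have hJsum : ∀ m, ∑ s ∈ Finset.range m,
      ∫⁻ z, A.payoff (Decision.haltsWith I.pos) s z ∂(J.runLaw R ρ) ≤ ENNReal.ofReal δ := by
    intro m
    rw [← lintegral_finsetSum _ fun s _ => A.measurable_payoff _ s]
    refine (lintegral_le_meas (s := {z | ∃ S, A.Outputs z S ∧ S ≠ J.pos})
      (A.sum_payoff_haltsWith_le_one I.pos · m) fun z hz => ?_).trans hJ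
    refine Finset.sum_eq_zero fun s _ => A.payoff_haltsWith_of_not_outputs (fun h => hz ?_) s
    exact ⟨I.pos, h, hIJ.symm⟩
  set κ : ℝ≥0 := (5 * x ^ 2).toNNReal with hκ
  have hκ' : (κ : ℝ) = 5 * x ^ 2 := Real.coe_toNNReal _ (by positivity)
  have hsum : ENNReal.ofReal (2 * Real.log ((1 - δ) / δ)) *
        ∫⁻ z, ∑' s, A.payoff (Decision.haltsWith I.pos) s z ∂(I.runLaw R ρ) ≤
      ENNReal.ofReal (Real.log ((1 - δ) / δ)) +
        κ * ∫⁻ z, A.numArmDuels i z ∂(I.runLaw R ρ) := by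
    unfold numArmDuels
    rw [lintegral_tsum fun s => (A.measurable_payoff _ s).aemeasurable,
      lintegral_tsum fun s => (A.measurable_payoff _ s).aemeasurable, ← ENNReal.tsum_mul_left]
    refine ENNReal.tsum_le_of_sum_range_le fun m => ?_
    rw [← Finset.mul_sum]
    refine (A.sum_payoff_haltsWith_le hA I J R ρ I.pos i κ hM hN (by simpa only [hκ'] using hMN)
      m h0 hδ (hJsum m)).trans ?_
    gcongr
    exact ENNReal.sum_le_tsum _
  have hout : ENNReal.ofReal (1 - δ) ≤
      ∫⁻ z, ∑' s, A.payoff (Decision.haltsWith I.pos) s z ∂(I.runLaw R ρ) :=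
    (A.le_runLaw_outputs_pos hA ρ h0.le I hI hfin).trans
      (meas_le_lintegral₀ (Measurable.tsum fun s => A.measurable_payoff _ s).aemeasurable
        fun z hz => A.one_le_tsum_payoff_haltsWith hz)
  have hfinal := (mul_le_mul_right hout _).trans hsum
  -- Splitting `2 * (1 - δ)` as `1 + (1 - 2 * δ)` lets one `log ((1 - δ) / δ)` cancel against the
  -- right-hand side.
  rw [← ENNReal.ofReal_mul (by positivity), show 2 * Real.log ((1 - δ) / δ) * (1 - δ) =
      Real.log ((1 - δ) / δ) + (1 - 2 * δ) * Real.log ((1 - δ) / δ) by ring,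
    ENNReal.ofReal_add hl (mul_nonneg (by linarith) hl)] at hfinal
  exact (ENNReal.ofReal_le_ofReal (log_one_div_two_mul_le h0 h1)).trans
    ((ENNReal.add_le_add_iff_left ENNReal.ofReal_ne_top).mp hfinal)

end Algorithm

/-! ### Optimizing the shift and summing over arms. -/

/-- For a positive gap the best shift is `x = g`. A zero gap allows arbitrarily small `x`, which
forces `E = ∞`. -/
theorem inv_sq_mul_le_of_forall {g L : ℝ} {E : ℝ≥0∞} (hg : 0 ≤ g) (hg' : g ≤ 1 / 4) (hL : 0 < L)
    (h : ∀ x, 0 < x → x ≤ 1 / 4 → g ≤ x → ENNReal.ofReal L ≤ ENNReal.ofReal (5 * x ^ 2) * E) :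
    (ENNReal.ofReal (g ^ 2))⁻¹ * ENNReal.ofReal L ≤ 5 * E := by
  rcases hg.eq_or_lt with rfl | hpos
  · suffices hE : E = ∞ by rw [hE]; simp
    by_contra hE
    lift E to ℝ≥0 using hE
    have hE0 : (0 : ℝ) ≤ E := E.2
    -- For this `x`, `5 * x ^ 2 * E ≤ (5 / 4) * (x * E) ≤ (5 / 8) * L < L`, a contradiction.
    have hx : 0 < min (1 / 4) (L / (2 * (E + 1))) := by positivity
    have := h _ hx (min_le_left _ _) hx.le
    set x := min (1 / 4) (L / (2 * ((E : ℝ) + 1))) with hxdef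
    rw [← ENNReal.ofReal_coe_nnreal, ← ENNReal.ofReal_mul (by positivity),
      ENNReal.ofReal_le_ofReal_iff (by positivity)] at this
    have h1 : x ≤ 1 / 4 := min_le_left _ _
    have h2 : x * (2 * ((E : ℝ) + 1)) ≤ L := by
      rw [← le_div_iff₀ (by positivity)]
      exact min_le_right _ _
    nlinarith [mul_nonneg (mul_nonneg hx.le (sub_nonneg.mpr h1)) hE0]
  · have hne : ENNReal.ofReal (g ^ 2) ≠ 0 := by simpa using (pow_pos hpos 2).not_ge
    calc (ENNReal.ofReal (g ^ 2))⁻¹ * ENNReal.ofReal L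
        ≤ (ENNReal.ofReal (g ^ 2))⁻¹ * (ENNReal.ofReal (5 * g ^ 2) * E) := by
          gcongr
          exact h g hpos hg' le_rfl
      _ = ((ENNReal.ofReal (g ^ 2))⁻¹ * ENNReal.ofReal (g ^ 2)) * (5 * E) := by
          rw [ENNReal.ofReal_mul (by norm_num), ENNReal.ofReal_ofNat]
          ring
      _ = 5 * E := by
          rw [ENNReal.inv_mul_cancel hne ENNReal.ofReal_ne_top, one_mul]

end TBPDC

theorem corollary1 {K : ℕ} {Ξ : Type*} [MeasurableSpace Ξ] (ρ : Measure Ξ) [IsProbabilityMeasure ρ]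
    (τ R δ : ℝ) (hR : 0 < R) (hδ0 : 0 < δ) (hδ : δ ≤ 0.15)
    (u l : Fin K)
    (A : TBPDC.Algorithm K Ξ) (hduel : A.UsesOnlyDuels)
    (hA : ∀ J : TBPDC.Problem K τ, u ∈ J.pos → l ∉ J.pos → A.ErrsAtMost ρ R δ J)
    (I : TBPDC.Problem K τ) (hu : I.IsWorstPositive u) (hl : I.IsBestNegative l)
    (hM : ∀ i j, (3 / 8 : ℝ) ≤ I.M i j) :
    ENNReal.ofReal (min (1 / 10) (R ^ 2 / 2)) * I.Hc1 u l * ENNReal.ofReal (Real.log (1 / (2 * δ)))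
      ≤ A.expectedDuels ρ R I := by
  by_cases hfin : A.expectedDuels ρ R I = ∞
  · rw [hfin]; exact le_top
  have hM' : ∀ a b, 3 / 8 ≤ (I.M a b : ℝ) ∧ (I.M a b : ℝ) ≤ 5 / 8 := fun a b =>
    ⟨hM a b, by linarith [hM b a, I.M_symm a b]⟩
  have hul : u ≠ l := fun h => hl.1 (h ▸ hu.1)
  have hK : 1 < K := by
    have := Fintype.one_lt_card_iff.mpr ⟨u, l, hul⟩
    simpa using this
  have hL : 0 < Real.log (1 / (2 * δ)) := by
    refine Real.log_pos ?_
    rw [one_lt_div (by positivity)]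
    norm_num at hδ
    linarith
  have harm : ∀ i ∈ (Finset.univ.erase u).erase l,
      (ENNReal.ofReal (I.gap u l i ^ 2))⁻¹ * ENNReal.ofReal (Real.log (1 / (2 * δ))) ≤
        5 * ∫⁻ z, A.numArmDuels i z ∂(I.runLaw R ρ) := by
    intro i hi
    have hil : i ≠ l := Finset.ne_of_mem_erase hi
    have hiu : i ≠ u := Finset.ne_of_mem_erase (Finset.mem_of_mem_erase hi)
    -- All Borda scores lie in `[3/8, 5/8]`. A shift by at most `1/4` then keeps the entries in
    -- `[1/8, 7/8]`, where the entropy bound applies.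
    have hg : I.gap u l i ≤ 1 / 4 := by
      have hb := TBPDC.bordaScore_mem_Icc hK I.M hM'
      unfold TBPDC.Problem.gap TBPDC.Problem.p
      split_ifs <;> linarith [hb i, (hb i).1, (hb i).2, (hb u).1, (hb l).2]
    refine TBPDC.inv_sq_mul_le_of_forall (I.gap_nonneg hu hl i) hg hL fun x hx hx' hgx => ?_
    obtain ⟨J, huJ, hlJ, hne, hN, hMN⟩ := I.exists_flip hu hl hiu hil hM' hx hx' hgx
    exact A.log_le_mul_expected_numArmDuels hduel ρ hδ0 hδ I J (hA I hu.1 hl.1) (hA J huJ hlJ)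
      hfin hne i x hM' hN hMN
  have hsum : ∑ i ∈ (Finset.univ.erase u).erase l, ∫⁻ z, A.numArmDuels i z ∂(I.runLaw R ρ) ≤
      2 * A.expectedDuels ρ R I := by
    rw [← lintegral_finsetSum _ fun i _ => A.measurable_numArmDuels i,
      TBPDC.Algorithm.expectedDuels, ← lintegral_const_mul _ A.measurable_numDuels]
    exact lintegral_mono fun z => A.sum_numArmDuels_le _ z
  calc ENNReal.ofReal (min (1 / 10) (R ^ 2 / 2)) * I.Hc1 u l *
        ENNReal.ofReal (Real.log (1 / (2 * δ)))
      ≤ ENNReal.ofReal (1 / 10) * I.Hc1 u l * ENNReal.ofReal (Real.log (1 / (2 * δ))) := by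
        gcongr
        exact min_le_left _ _
    _ = ENNReal.ofReal (1 / 10) * ∑ i ∈ (Finset.univ.erase u).erase l,
          (ENNReal.ofReal (I.gap u l i ^ 2))⁻¹ * ENNReal.ofReal (Real.log (1 / (2 * δ))) := by
        rw [TBPDC.Problem.Hc1, mul_assoc, Finset.sum_mul]
    -- The 5 is the entropy constant, and the 2 counts the arms of a duel.
    _ ≤ ENNReal.ofReal (1 / 10) * (5 * (2 * A.expectedDuels ρ R I)) := by
        gcongr
        refine (Finset.sum_le_sum harm).trans ?_
        rw [← Finset.mul_sum]
        gcongr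
    _ = A.expectedDuels ρ R I := by
        rw [← mul_assoc, ← mul_assoc, ← ENNReal.ofReal_ofNat 5, ← ENNReal.ofReal_ofNat 2,
          ← ENNReal.ofReal_mul (by norm_num), ← ENNReal.ofReal_mul (by norm_num)]
        norm_num
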